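/- Let $X$ be a real Banach space of finite dimension $d$ with a fixed basis $e_1,\dots,e_d$, let $B(x,R)$ denote closed balls, let $d_{\mathcal H}$ be the Hausdorff distance between subsets of $X$ (equal to $\infty$ if exactly one of the two sets is empty), and let $F\subseteq X$ be non-empty. An arithmetic patch of size $k$ and scale $\delta>0$ is a set $\{t+\delta\sum_{i=1}^d x_ie_i : x_1,\dots,x_d\in\{0,\dots,k-1\}\}$ with $t\in X$. For a subset $A$ of a metric space, the Assouad dimension $\dim_{\mathrm A}A\in[0,\infty]$ is the infimum of all $s\ge 0$ for which there is $C>0$ such that, for all $0<r<R$ and all $x\in A$, the set $B(x,R)\cap A$ can be covered by at most $C(R/r)^s$ open sets of diameter at most $r$. A topological embedding $\phi:A\to Y$ into a metric space is quasi-symmetric if there is a homeomorphism $\eta:[0,\infty)\to[0,\infty)$ such that $d(x,a)\le t\,d(x,b)$ implies $d(\phi(x),\phi(a))\le\eta(t)\,d(\phi(x),\phi(b))$ for all $x,a,b\in A$ and $t\ge0$. The conformal Assouad dimension of $F$ is the infimum of $\dim_{\mathrm A}\phi(F)$ over all quasi-symmetric maps $\phi$ from $F$ into metric spaces. A compact set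 $E\subseteq B(0,1)$ is a weak tangent to $F$ if there is a sequence of similarity maps $T_n:X\to X$ (maps multiplying all distances by a positive constant) with $d_{\mathcal H}(E,\,T_n(F)\cap B(0,1))\to0$. Then the following are equivalent: 1. $F$ asymptotically contains arbitrarily large arithmetic patches: for all $k\in\mathbb N$ and $\varepsilon>0$ there are $\delta>0$, an arithmetic patch $P$ of size $k$ and scale $\delta$, and a set $E\subseteq F$ with $d_{\mathcal H}(E,P)\le\varepsilon\delta$; 2. $F$ has the asymptotic Steinhaus property: for every finite $P\subset X$ and $\varepsilon>0$ there are $\delta>0$, $t\in X$ and $E\subseteq F$ with $d_{\mathcal H}(E,t+\delta P)\le\varepsilon\delta$; 3. $\dim_{\mathrm A}F=d$; 4. the conformal Assouad dimension of $F$ equals $d$; 5. $F$ has a weak tangent with non-empty interior; 6. the closed unit ball $B(0,1)$ is a weak tangent to $F$. -/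

import Mathlib

open Set Filter Topology
open scoped NNReal ENNReal

noncomputable section

namespace AssouadPatch

/-- The arithmetic patch of size `k` and scale `δ` based at `t`, with respect to the basis `b`:
the points `t + δ ∑ i, x i • b i` with every `x i` in `{0, …, k - 1}`. -/
def patch {X : Type*} [NormedAddCommGroup X] [NormedSpace ℝ X] {d : ℕ}
    (b : Module.Basis (Fin d) ℝ X) (k : ℕ) (δ : ℝ) (t : X) : Set X :=
  {p | ∃ x : Fin d → ℕ, (∀ i, x i < k) ∧ p = t + δ • ∑ i, (x i : ℝ) • b i}

/-- `F` asymptotically contains arbitrarily large arithmetic patches with respect to `b`.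
The Hausdorff distance is the `[0, ∞]`-valued one, so that the distance between an empty and a
non-empty set is `∞`. -/
def AsymptoticallyContainsPatches {X : Type*} [NormedAddCommGroup X] [NormedSpace ℝ X] {d : ℕ}
    (b : Module.Basis (Fin d) ℝ X) (F : Set X) : Prop :=
  ∀ k : ℕ, ∀ ε : ℝ, 0 < ε → ∃ δ : ℝ, 0 < δ ∧ ∃ t : X, ∃ E : Set X, E ⊆ F ∧
    Metric.hausdorffEDist E (patch b k δ t) ≤ ENNReal.ofReal (ε * δ)

/-- The asymptotic Steinhaus property. -/
def AsymptoticSteinhaus {X : Type*} [NormedAddCommGroup X] [NormedSpace ℝ X]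
    (F : Set X) : Prop :=
  ∀ P : Set X, P.Finite → ∀ ε : ℝ, 0 < ε → ∃ δ : ℝ, 0 < δ ∧ ∃ t : X, ∃ E : Set X, E ⊆ F ∧
    Metric.hausdorffEDist E ((fun p => t + δ • p) '' P) ≤ ENNReal.ofReal (ε * δ)

/-- The least number of open sets of diameter at most `r` needed to cover `E`
(`⊤` if there is no finite cover of this kind). -/
def coverNumber {X : Type*} [MetricSpace X] (r : ℝ) (E : Set X) : ℕ∞ :=
  ⨅ (U : Set (Set X)) (_ : ∀ V ∈ U, IsOpen V ∧ Metric.ediam V ≤ ENNReal.ofReal r)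
    (_ : E ⊆ ⋃₀ U), U.encard

/-- `s` is an admissible exponent for the Assouad dimension of `F`. -/
def IsAssouadExponent {X : Type*} [MetricSpace X] (F : Set X) (s : ℝ≥0) : Prop :=
  ∃ C : ℝ, 0 < C ∧ ∀ R : ℝ, 0 < R → ∀ r : ℝ, 0 < r → r < R → ∀ x ∈ F,
    (coverNumber r (Metric.closedBall x R ∩ F) : ℝ≥0∞) ≤ ENNReal.ofReal (C * (R / r) ^ (s : ℝ))

/-- The Assouad dimension (`∞` if there is no admissible exponent). -/
def assouadDim {X : Type*} [MetricSpace X] (F : Set X) : ℝ≥0∞ :=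
  ⨅ (s : ℝ≥0) (_ : IsAssouadExponent F s), (s : ℝ≥0∞)

/-- Quasi-symmetric maps: topological embeddings `f` for which there is a homeomorphism `η` of
`[0, ∞)` such that `d(x, a) ≤ t d(x, b)` implies `d(f x, f a) ≤ η(t) d(f x, f b)`. -/
def IsQuasisymmetric {X Y : Type*} [MetricSpace X] [MetricSpace Y] (f : X → Y) : Prop :=
  IsEmbedding f ∧ ∃ η : ℝ≥0 ≃ₜ ℝ≥0, ∀ (x a b : X) (t : ℝ≥0),
    nndist x a ≤ t * nndist x b → nndist (f x) (f a) ≤ η t * nndist (f x) (f b)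

universe u

/-- The conformal Assouad dimension: the infimum of the Assouad dimensions of the images of `F`
under quasi-symmetric maps of `F` into arbitrary metric spaces. An image of `F` is in bijection
with a type of the universe of `X`, so this universe loses no image up to isometry. -/
def conformalAssouadDim {X : Type u} [MetricSpace X] (F : Set X) : ℝ≥0∞ :=
  ⨅ (Y : Type u) (_ : MetricSpace Y) (f : F → Y) (_ : IsQuasisymmetric f), assouadDim (range f)

/-- `E` is a weak tangent to `F`: a compact subset of the closed unit ball that is the limit in
Hausdorff distance of the sets `T k (F) ∩ B(0, 1)` for a sequence of similarities `T k`. -/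
def IsWeakTangent {X : Type*} [NormedAddCommGroup X] [NormedSpace ℝ X] (E F : Set X) : Prop :=
  IsCompact E ∧ E ⊆ Metric.closedBall 0 1 ∧ ∃ T : ℕ → Dilation X X,
    Tendsto (fun k => Metric.hausdorffEDist E (T k '' F ∩ Metric.closedBall 0 1)) atTop (𝓝 0)

end AssouadPatch

end

namespace AssouadPatch

/-! ### Covering numbers -/

/-! The hub is the sandwich `conformalAssouadDim F ≤ assouadDim F ≤ d`, where the second bound comes
from repeatedly halving coordinate cubes. Two facts close the circle.

Full dimension forbids uniform porosity. If every ball had a hole of fixed relative size, then for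
some `N` every cube could be cut into `N ^ d` subcubes of which one misses `F`; iterating gives the
exponent `log_N (N ^ d - 1) < d`. So `F` is nearly dense in suitable balls
(`isAlmostDenseInBalls_of_assouadDim_eq`). Placing a scaled finite set in such a ball gives the
Steinhaus property, hence patches; rescaling such balls to the unit ball gives the unit ball as a
weak tangent.

Conversely, approximate patches, or a tangent with interior, yield uniformly bi-Lipschitz copies of
arbitrarily large grids (`HasLargeGrids`), and these force conformal dimension at least `d` by a
length-volume argument (`le_of_isAssouadExponent_of_hasLargeGrids`). Let `L` be the span of a
quasi-symmetric image of `{0, …, N} ^ d`. Each of `N ^ (d - 1)` parallel lines joins points at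
distance at least a constant times `L`, so the edge lengths `ρ` have sum at least a constant times
`N ^ (d - 1) * L`. The base points of edges with `ρ ≥ r` are separated at scale `r`, so an exponent
`s` allows only a constant times `(L / r) ^ s` of them, and `∑ ρ ^ p` is bounded by a constant times
`L ^ p` for each `p > s`, uniformly in `N`. If `s < p < d` and `p ≥ 1`, Hölder over `N ^ d` edges
bounds `N ^ (d - p)`, which is absurd. For `d = 1` one has `p < 1`, and the contradiction comes from
the longest edge being `o(L)`. -/

theorem coverNumber_le_of_finset {X ι : Type*} [MetricSpace X] {r : ℝ} {E : Set X} (S : Finset ι)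
    (V : ι → Set X) (hopen : ∀ i ∈ S, IsOpen (V i))
    (hdiam : ∀ i ∈ S, Metric.ediam (V i) ≤ ENNReal.ofReal r) (hE : E ⊆ ⋃ i ∈ S, V i) :
    coverNumber r E ≤ S.card := by
  have h : coverNumber r E ≤ (V '' (S : Set ι)).encard := by
    refine iInf₂_le_of_le (V '' (S : Set ι)) ?_ (iInf_le_of_le ?_ le_rfl)
    · rintro _ ⟨i, hi, rfl⟩
      exact ⟨hopen i hi, hdiam i hi⟩
    · simpa [sUnion_image] using hE
  refine h.trans ((encard_image_le _ _).trans ?_)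
  simp

/-- Every set of the cover contains at most one point of an `r`-separated family. -/
theorem card_le_coverNumber {X ι : Type*} [MetricSpace X] {r : ℝ} {E : Set X} (A : Finset ι)
    (y : ι → X) (hr : 0 ≤ r) (hy : ∀ i ∈ A, y i ∈ E)
    (hsep : ∀ i ∈ A, ∀ j ∈ A, i ≠ j → r < dist (y i) (y j)) :
    (A.card : ℕ∞) ≤ coverNumber r E := by
  refine le_iInf fun U => le_iInf fun hU => le_iInf fun hE => ?_
  have hex : ∀ i, ∃ V, i ∈ A → V ∈ U ∧ y i ∈ V := by
    intro i
    by_cases hi : i ∈ A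
    · obtain ⟨V, hV, hiV⟩ := hE (hy i hi)
      exact ⟨V, fun _ => ⟨hV, hiV⟩⟩
    · exact ⟨∅, fun h => absurd h hi⟩
  choose V hV using hex
  rw [← encard_coe_eq_coe_finsetCard]
  refine encard_le_encard_of_injOn (f := V) (fun i hi => (hV i hi).1) ?_
  intro i hi j hj hij
  by_contra hne
  have h1 := (Metric.edist_le_ediam_of_mem (hV i hi).2 (hij ▸ (hV j hj).2)).trans
    (hU _ (hV i hi).1).2
  rw [edist_dist, ENNReal.ofReal_le_ofReal_iff hr] at h1
  exact absurd (hsep i hi j hj hne) (not_lt.2 h1)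

theorem IsAssouadExponent.mono {X : Type*} [MetricSpace X] {F : Set X} {s t : ℝ≥0}
    (h : IsAssouadExponent F s) (hst : s ≤ t) : IsAssouadExponent F t := by
  obtain ⟨C, hC, h⟩ := h
  refine ⟨C, hC, fun R hR r hr hrR x hx => (h R hR r hr hrR x hx).trans ?_⟩
  refine ENNReal.ofReal_le_ofReal (mul_le_mul_of_nonneg_left ?_ hC.le)
  exact Real.rpow_le_rpow_of_exponent_le ((one_le_div hr).2 hrR.le) (by exact_mod_cast hst)

theorem assouadDim_le {X : Type*} [MetricSpace X] {F : Set X} {s : ℝ≥0}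
    (h : IsAssouadExponent F s) : assouadDim F ≤ s :=
  iInf₂_le s h

/-! ### Sums of powers of a finite family with a weak-type bound -/

/-- If at most `C (L / r) ^ s` members of a finite non-negative family are at least `r`, for every
`r > 0`, then for `p > s` the sum of the `p`-th powers is at most a constant times `L ^ p`. -/
theorem sum_rpow_le_of_card_le {ι : Type*} [DecidableEq ι] {C L s p : ℝ} (hC : 0 < C) (hL : 0 < L)
    (hs : 0 < s) (hsp : s < p) (ρ : ι → ℝ) (A : Finset ι) (hρ : ∀ i ∈ A, 0 ≤ ρ i)
    (hcard : ∀ r, 0 < r → ∀ B ⊆ A, (∀ i ∈ B, r ≤ ρ i) → (B.card : ℝ) ≤ C * (L / r) ^ s) :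
    ∑ i ∈ A, ρ i ^ p ≤ C ^ (p / s) * (∑' n : ℕ, (n : ℝ) ^ (-(p / s))) * L ^ p := by
  have hp : 0 < p := hs.trans hsp
  have hq : 1 < p / s := (one_lt_div hs).2 hsp
  have hsum : Summable fun n : ℕ => (n : ℝ) ^ (-(p / s)) :=
    Real.summable_nat_rpow.2 (by linarith)
  -- Peel off the smallest member: if it is positive, the counting bound at `r` equal to it gives `ρ
  -- i ^ p ≤ C ^ (p / s) * L ^ p * n ^ (-(p / s))` with `n = B.card`. The term `k = 0` is harmless,
  -- since `0` to a nonzero real power is `0`.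
  have key : ∀ n : ℕ, ∀ B ⊆ A, B.card = n → ∑ i ∈ B, ρ i ^ p ≤
      ∑ k ∈ Finset.range (n + 1), C ^ (p / s) * L ^ p * (k : ℝ) ^ (-(p / s)) := by
    intro n
    induction n with
    | zero =>
      intro B _ hB
      rw [Finset.card_eq_zero.1 hB, Finset.sum_empty]
      exact Finset.sum_nonneg fun k _ => by positivity
    | succ n ih =>
      intro B hBA hB
      obtain ⟨i, hi, hmin⟩ := B.exists_min_image ρ (Finset.card_pos.1 (by omega))
      rw [Finset.sum_range_succ, ← Finset.sum_erase_add _ _ hi]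
      refine add_le_add (ih _ ((Finset.erase_subset _ _).trans hBA) ?_) ?_
      · rw [Finset.card_erase_of_mem hi, hB]; rfl
      · rcases (hρ i (hBA hi)).eq_or_lt with h0 | h0
        · rw [← h0, Real.zero_rpow hp.ne']; positivity
        · have h1 := hcard (ρ i) h0 B hBA hmin
          rw [hB] at h1
          have hn : (0 : ℝ) < ((n + 1 : ℕ) : ℝ) := by positivity
          have h2 := Real.rpow_le_rpow hn.le h1 (by positivity : 0 ≤ p / s)
          rw [Real.mul_rpow hC.le (by positivity), ← Real.rpow_mul (by positivity),
            mul_div_cancel₀ _ hs.ne', Real.div_rpow hL.le h0.le] at h2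
          rw [Real.rpow_neg hn.le, ← div_eq_mul_inv, le_div_iff₀ (by positivity)]
          rw [← mul_div_assoc, le_div_iff₀ (by positivity)] at h2
          linarith
  refine (key _ A subset_rfl rfl).trans ?_
  rw [← Finset.mul_sum]
  have := hsum.sum_le_tsum (Finset.range (A.card + 1)) (fun k _ => by positivity)
  calc _ ≤ C ^ (p / s) * L ^ p * ∑' n : ℕ, (n : ℝ) ^ (-(p / s)) := by gcongr
    _ = _ := by ring

/-! ### Integer grids -/

theorem dist_le_of_forall_le {d N : ℕ} {g h : Fin d → ℕ} (hg : ∀ i, g i ≤ N) (hh : ∀ i, h i ≤ N) :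
    dist g h ≤ N := by
  refine (dist_pi_le_iff (Nat.cast_nonneg N)).2 fun i => ?_
  have h1 : (g i : ℝ) ≤ N := by exact_mod_cast hg i
  have h2 : (h i : ℝ) ≤ N := by exact_mod_cast hh i
  rw [Nat.dist_eq, abs_le]
  constructor <;> linarith [(g i).cast_nonneg (α := ℝ), (h i).cast_nonneg (α := ℝ)]

theorem one_le_dist_of_ne {d : ℕ} {g h : Fin d → ℕ} (hne : g ≠ h) : 1 ≤ dist g h := by
  obtain ⟨i, hi⟩ := Function.ne_iff.1 hne
  exact (Nat.pairwise_one_le_dist hi).trans (dist_le_pi_dist g h i)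

theorem dist_cons_succ_le {m : ℕ} (j : ℕ) (h : Fin m → ℕ) :
    dist (Fin.cons j h : Fin (m + 1) → ℕ) (Fin.cons (j + 1) h : Fin (m + 1) → ℕ) ≤ 1 := by
  refine (dist_pi_le_iff zero_le_one).2 fun i => ?_
  refine Fin.cases ?_ (fun i => ?_) i
  · simp [Nat.dist_eq]
  · simp

theorem abs_sub_le_dist_cons {m : ℕ} (j k : ℕ) (h h' : Fin m → ℕ) :
    |(j : ℝ) - k| ≤ dist (Fin.cons j h : Fin (m + 1) → ℕ) (Fin.cons k h' : Fin (m + 1) → ℕ) := by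
  have := dist_le_pi_dist (Fin.cons j h : Fin (m + 1) → ℕ) (Fin.cons k h' : Fin (m + 1) → ℕ) 0
  simpa [Nat.dist_eq] using this

theorem cons_le {m N j : ℕ} {h : Fin m → ℕ} (hj : j ≤ N) (hh : ∀ i, h i ≤ N) :
    ∀ i, (Fin.cons j h : Fin (m + 1) → ℕ) i ≤ N :=
  Fin.cases hj hh

/-- The base points of the edges in the first coordinate direction of the grid `{0, …, N}^(m+1)`
that start in `{0, …, N-1}^(m+1)`. -/
def edgeIndex (m N : ℕ) : Finset (ℕ × (Fin m → ℕ)) :=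
  Finset.range N ×ˢ Fintype.piFinset fun _ => Finset.range N

theorem mem_edgeIndex {m N : ℕ} {q : ℕ × (Fin m → ℕ)} :
    q ∈ edgeIndex m N ↔ q.1 < N ∧ ∀ i, q.2 i < N := by
  simp [edgeIndex]

theorem card_edgeIndex (m N : ℕ) : (edgeIndex m N).card = N ^ (m + 1) := by
  simp [edgeIndex, pow_succ, mul_comm]

/-- The length of the edge of the image grid `y` based at `q`. -/
noncomputable def edgeLength {Y : Type*} [MetricSpace Y] {m : ℕ} (y : (Fin (m + 1) → ℕ) → Y)
    (q : ℕ × (Fin m → ℕ)) : ℝ :=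
  dist (y (Fin.cons q.1 q.2)) (y (Fin.cons (q.1 + 1) q.2))

/-- A map of the grid `{0, …, N}^d` that does not reverse distances by more than a factor `H`. -/
def IsWeaklyQuasisymmetricOnGrid {Y : Type*} [MetricSpace Y] {d : ℕ} (N : ℕ) (H : ℝ)
    (y : (Fin d → ℕ) → Y) : Prop :=
  ∀ g a c : Fin d → ℕ, (∀ i, g i ≤ N) → (∀ i, a i ≤ N) → (∀ i, c i ≤ N) →
    dist g a ≤ dist g c → dist (y g) (y a) ≤ H * dist (y g) (y c)

/-- The distance of the images of the end points of the base edge of the grid. -/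
noncomputable def gridSpan {Y : Type*} [MetricSpace Y] {m : ℕ} (N : ℕ)
    (y : (Fin (m + 1) → ℕ) → Y) : ℝ :=
  dist (y 0) (y (Fin.cons N 0))

section Grid

variable {Y : Type*} [MetricSpace Y] {m N : ℕ} {H : ℝ} {y : (Fin (m + 1) → ℕ) → Y}

/-- The base edge already realises the sup-metric diameter `N` of the grid. -/
theorem dist_zero_le_gridSpan (hy : IsWeaklyQuasisymmetricOnGrid N H y) {g : Fin (m + 1) → ℕ}
    (hg : ∀ i, g i ≤ N) : dist (y 0) (y g) ≤ H * gridSpan N y := by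
  have h0 : ∀ i, (0 : Fin (m + 1) → ℕ) i ≤ N := fun i => Nat.zero_le _
  have hN : ∀ i, (Fin.cons N 0 : Fin (m + 1) → ℕ) i ≤ N := cons_le le_rfl fun i => Nat.zero_le _
  refine hy _ _ _ h0 hg hN ((dist_le_of_forall_le h0 hg).trans ?_)
  have := dist_le_pi_dist (0 : Fin (m + 1) → ℕ) (Fin.cons N 0 : Fin (m + 1) → ℕ) 0
  simpa [Nat.dist_eq] using this

/-- The ends of each line are also at the maximal distance `N`, so both ends of the base edge are
controlled from the start of the line; the triangle inequality doubles `H`. -/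
theorem gridSpan_le_line (hy : IsWeaklyQuasisymmetricOnGrid N H y) {h : Fin m → ℕ}
    (hh : ∀ i, h i ≤ N) :
    gridSpan N y ≤ 2 * H * dist (y (Fin.cons 0 h)) (y (Fin.cons N h)) := by
  have h0 : ∀ i, (0 : Fin (m + 1) → ℕ) i ≤ N := fun i => Nat.zero_le _
  have hN : ∀ i, (Fin.cons N 0 : Fin (m + 1) → ℕ) i ≤ N := cons_le le_rfl fun i => Nat.zero_le _
  have hg : ∀ i, (Fin.cons 0 h : Fin (m + 1) → ℕ) i ≤ N := cons_le (Nat.zero_le _) hh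
  have hg' : ∀ i, (Fin.cons N h : Fin (m + 1) → ℕ) i ≤ N := cons_le le_rfl hh
  have hd : (N : ℝ) ≤ dist (Fin.cons 0 h : Fin (m + 1) → ℕ) (Fin.cons N h : Fin (m + 1) → ℕ) := by
    simpa using abs_sub_le_dist_cons 0 N h h
  have h1 := hy _ _ _ hg h0 hg' ((dist_le_of_forall_le hg h0).trans hd)
  have h2 := hy _ _ _ hg hN hg' ((dist_le_of_forall_le hg hN).trans hd)
  have h3 := dist_triangle_left (y 0) (y (Fin.cons N 0)) (y (Fin.cons 0 h))
  rw [gridSpan]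
  linarith

/-- The edges along every line of the grid connect points at distance comparable to the span. -/
theorem pow_mul_gridSpan_le_sum (hH : 0 ≤ H) (hy : IsWeaklyQuasisymmetricOnGrid N H y) :
    (N : ℝ) ^ m * gridSpan N y ≤ 2 * H * ∑ q ∈ edgeIndex m N, edgeLength y q := by
  rw [edgeIndex, Finset.sum_product_right, Finset.mul_sum]
  have hc : ((Fintype.piFinset fun _ : Fin m => Finset.range N).card : ℝ) = (N : ℝ) ^ m := by
    simp
  rw [← hc, ← nsmul_eq_mul]
  refine Finset.card_nsmul_le_sum _ _ _ fun h hh => ?_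
  have hh' : ∀ i, h i ≤ N := fun i => (by simpa using hh : ∀ i, h i < N) i |>.le
  refine (gridSpan_le_line hy hh').trans ?_
  have := dist_le_range_sum_dist (fun j => y (Fin.cons j h)) N
  unfold edgeLength
  gcongr

/-- Edges have grid length `1`, the least distance between distinct grid points. Hence long edges
have well-separated base points. -/
theorem edgeLength_le_dist (hy : IsWeaklyQuasisymmetricOnGrid N H y) {q q' : ℕ × (Fin m → ℕ)}
    (hq : q ∈ edgeIndex m N) (hq' : q' ∈ edgeIndex m N) (hne : q ≠ q') :
    edgeLength y q ≤ H * dist (y (Fin.cons q.1 q.2)) (y (Fin.cons q'.1 q'.2)) := by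
  rw [mem_edgeIndex] at hq hq'
  refine hy _ _ _ (cons_le hq.1.le fun i => (hq.2 i).le) (cons_le hq.1 fun i => (hq.2 i).le)
    (cons_le hq'.1.le fun i => (hq'.2 i).le) ((dist_cons_succ_le _ _).trans (one_le_dist_of_ne ?_))
  intro h
  obtain ⟨h1, h2⟩ := Fin.cons_inj.1 h
  exact hne (Prod.ext h1 h2)

theorem card_edges_le (hH : 1 ≤ H) (hy : IsWeaklyQuasisymmetricOnGrid N H y)
    (hL : 0 < gridSpan N y) {Z : Set Y} (hZ : ∀ g, y g ∈ Z) {C : ℝ} {s : ℝ≥0} (hC : 0 < C)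
    (hexp : ∀ R : ℝ, 0 < R → ∀ r : ℝ, 0 < r → r < R → ∀ x ∈ Z,
      (coverNumber r (Metric.closedBall x R ∩ Z) : ℝ≥0∞) ≤ ENNReal.ofReal (C * (R / r) ^ (s : ℝ)))
    {r : ℝ} (hr : 0 < r) {B : Finset (ℕ × (Fin m → ℕ))} (hB : B ⊆ edgeIndex m N)
    (hrB : ∀ q ∈ B, r ≤ edgeLength y q) :
    (B.card : ℝ) ≤ C * (4 * H ^ 2) ^ (s : ℝ) * (gridSpan N y / r) ^ (s : ℝ) := by
  have hH0 : 0 < H := by linarith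
  set L := gridSpan N y
  rcases B.eq_empty_or_nonempty with rfl | ⟨q₀, hq₀⟩
  · simp only [Finset.card_empty, Nat.cast_zero]; positivity
  have hbox : ∀ q ∈ B, ∀ i, (Fin.cons q.1 q.2 : Fin (m + 1) → ℕ) i ≤ N := fun q hq =>
    have := mem_edgeIndex.1 (hB hq)
    cons_le this.1.le fun i => (this.2 i).le
  have hball : ∀ q ∈ B, dist (y 0) (y (Fin.cons q.1 q.2)) ≤ H * L := fun q hq =>
    dist_zero_le_gridSpan hy (hbox q hq)
  have hrL : r ≤ 2 * (H * L) := by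
    have hq := mem_edgeIndex.1 (hB hq₀)
    have h1 := dist_zero_le_gridSpan hy (cons_le hq.1 fun i => (hq.2 i).le)
    have h2 := dist_triangle_left (y (Fin.cons q₀.1 q₀.2)) (y (Fin.cons (q₀.1 + 1) q₀.2)) (y 0)
    have h3 := hrB q₀ hq₀
    have h4 := hball q₀ hq₀
    unfold edgeLength at h3
    linarith
  have hlt : r / (2 * H) < 2 * H * L := by
    rw [div_lt_iff₀ (by positivity)]
    nlinarith [mul_pos hH0 hL]
  -- The base points are at least `r / H` apart and within `H * L` of `y 0`. One factor `2` makes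
  -- the separation strict and the other keeps the two scales strictly ordered.
  have h1 : (B.card : ℕ∞) ≤ coverNumber (r / (2 * H)) (Metric.closedBall (y 0) (2 * H * L) ∩ Z) := by
    refine card_le_coverNumber B (fun q => y (Fin.cons q.1 q.2)) (by positivity) ?_ ?_
    · intro q hq
      refine ⟨?_, hZ _⟩
      rw [Metric.mem_closedBall']
      have := hball q hq
      nlinarith [mul_pos hH0 hL]
    · intro q hq q' hq' hne
      have h2 := (hrB q hq).trans (edgeLength_le_dist hy (hB hq) (hB hq') hne)
      rw [div_lt_iff₀ (by positivity)]
      linarith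
  have h2 := (ENat.toENNReal_le.2 h1).trans
    (hexp (2 * H * L) (by positivity) (r / (2 * H)) (by positivity) hlt (y 0) (hZ 0))
  rw [ENat.toENNReal_coe, ENNReal.natCast_le_ofReal (Finset.card_ne_zero_of_mem hq₀)] at h2
  refine h2.trans (le_of_eq ?_)
  rw [mul_assoc C, ← Real.mul_rpow (by positivity) (by positivity)]
  congr 2
  field_simp
  ring

end Grid

/-! ### Quasi-symmetric images of large grids -/

/-- `F` contains arbitrarily large integer grids, up to scaling and uniformly bi-Lipschitz maps. -/
def HasLargeGrids {X : Type*} [MetricSpace X] (d : ℕ) (F : Set X) : Prop :=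
  ∃ K : ℝ≥0, ∀ N : ℕ, ∃ (x : (Fin d → ℕ) → F) (δ : ℝ), 0 < δ ∧
    ∀ g h : Fin d → ℕ, (∀ i, g i ≤ N) → (∀ i, h i ≤ N) →
      δ * dist g h ≤ dist (x g) (x h) ∧ dist (x g) (x h) ≤ K * (δ * dist g h)

/-- A decreasing `η` would be bounded by `η 0`, contrary to surjectivity; so `η` is increasing and
its least value is at `0`. -/
theorem homeomorph_nnreal_zero (η : ℝ≥0 ≃ₜ ℝ≥0) : η 0 = 0 := by
  have hmono : StrictMono η := by
    refine (η.continuous.strictMono_of_inj η.injective).resolve_right fun h => ?_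
    have h1 := h.antitone (zero_le : 0 ≤ η.symm (η 0 + 1))
    rw [η.apply_symm_apply] at h1
    exact absurd h1 (not_le.2 (lt_add_one _))
  have h1 := hmono.monotone (zero_le : 0 ≤ η.symm 0)
  rw [η.apply_symm_apply] at h1
  exact nonpos_iff_eq_zero.1 h1

theorem tendsto_homeomorph_nnreal_div (η : ℝ≥0 ≃ₜ ℝ≥0) (K : ℝ≥0) :
    Tendsto (fun N : ℕ => (η (K * (2 / (N : ℝ≥0))) : ℝ)) atTop (𝓝 0) := by
  have h1 : Tendsto (fun N : ℕ => K * (2 / (N : ℝ≥0))) atTop (𝓝 0) := by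
    rw [← NNReal.tendsto_coe]
    have : Tendsto (fun N : ℕ => 2 / (N : ℝ)) atTop (𝓝 0) := tendsto_const_div_atTop_nhds_zero_nat 2
    simpa using this.const_mul (K : ℝ)
  have h2 := (η.continuous.tendsto 0).comp h1
  rw [homeomorph_nnreal_zero, ← NNReal.tendsto_coe] at h2
  simpa using h2

theorem dist_quasisymmetric_grid_le {X Y : Type*} [MetricSpace X] [MetricSpace Y] {f : X → Y}
    {η : ℝ≥0 → ℝ≥0} (hf : ∀ (x a b : X) (t : ℝ≥0),
      nndist x a ≤ t * nndist x b → nndist (f x) (f a) ≤ η t * nndist (f x) (f b))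
    {d N : ℕ} {K : ℝ≥0} {δ : ℝ} (hδ : 0 < δ) {x : (Fin d → ℕ) → X}
    (hx : ∀ g h : Fin d → ℕ, (∀ i, g i ≤ N) → (∀ i, h i ≤ N) →
      δ * dist g h ≤ dist (x g) (x h) ∧ dist (x g) (x h) ≤ K * (δ * dist g h))
    {g a c : Fin d → ℕ} (hg : ∀ i, g i ≤ N) (ha : ∀ i, a i ≤ N) (hc : ∀ i, c i ≤ N) {t : ℝ≥0}
    (h : dist g a ≤ t * dist g c) :
    dist (f (x g)) (f (x a)) ≤ η (K * t) * dist (f (x g)) (f (x c)) := by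
  have h1 : dist (x g) (x a) ≤ (K * t : ℝ≥0) * dist (x g) (x c) := by
    calc dist (x g) (x a) ≤ K * (δ * dist g a) := (hx g a hg ha).2
      _ ≤ K * (δ * (t * dist g c)) := by gcongr
      _ = (K * t : ℝ≥0) * (δ * dist g c) := by push_cast; ring
      _ ≤ _ := by gcongr; exact (hx g c hg hc).1
  exact_mod_cast hf (x g) (x a) (x c) (K * t) (by exact_mod_cast h1)

/-- Every edge of a quasi-symmetric image of a large grid is short compared with the span. -/
theorem edgeLength_le_mul_gridSpan {Y : Type*} [MetricSpace Y] {m N : ℕ} {H θ : ℝ}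
    {y : (Fin (m + 1) → ℕ) → Y} (hθ : 0 ≤ θ) (hy : IsWeaklyQuasisymmetricOnGrid N H y)
    (hyθ : ∀ g a c : Fin (m + 1) → ℕ, (∀ i, g i ≤ N) → (∀ i, a i ≤ N) → (∀ i, c i ≤ N) →
      N * dist g a ≤ 2 * dist g c → dist (y g) (y a) ≤ θ * dist (y g) (y c))
    {q : ℕ × (Fin m → ℕ)} (hq : q ∈ edgeIndex m N) :
    edgeLength y q ≤ θ * (2 * H * gridSpan N y) := by
  rw [mem_edgeIndex] at hq
  have hg := cons_le hq.1.le fun i => (hq.2 i).le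
  have ha := cons_le (Nat.succ_le_of_lt hq.1) fun i => (hq.2 i).le
  -- The comparison point `c` will be whichever end of the base edge is at distance at least `N / 2`
  -- in the first coordinate.
  have key : ∀ c : Fin (m + 1) → ℕ, (∀ i, c i ≤ N) →
      (N : ℝ) ≤ 2 * dist (Fin.cons q.1 q.2 : Fin (m + 1) → ℕ) c →
      edgeLength y q ≤ θ * (2 * H * gridSpan N y) := by
    intro c hc hNc
    have h1 := dist_cons_succ_le q.1 q.2
    refine (hyθ _ _ c hg ha hc (le_trans ?_ hNc)).trans (mul_le_mul_of_nonneg_left ?_ hθ)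
    · exact mul_le_of_le_one_right (Nat.cast_nonneg N) h1
    · have h2 := dist_triangle_left (y (Fin.cons q.1 q.2)) (y c) (y 0)
      linarith [dist_zero_le_gridSpan hy hg, dist_zero_le_gridSpan hy hc]
  have hz := abs_sub_le_dist_cons q.1 0 q.2 (0 : Fin m → ℕ)
  have hN := abs_sub_le_dist_cons q.1 N q.2 (0 : Fin m → ℕ)
  rcases le_total ((N : ℝ) / 2) q.1 with h | h
  · refine key (Fin.cons 0 0) (cons_le (Nat.zero_le _) fun i => Nat.zero_le _) ?_
    have := le_abs_self ((q.1 : ℝ) - (0 : ℕ))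
    simp only [Nat.cast_zero, sub_zero] at this hz
    linarith
  · refine key (Fin.cons N 0) (cons_le le_rfl fun i => Nat.zero_le _) ?_
    have := neg_abs_le ((q.1 : ℝ) - N)
    linarith

/-- Write `ρ = ρ ^ (1 - p) * ρ ^ p` and bound the first factor by the largest edge. This replaces
Hölder when `p < 1`. -/
theorem one_le_of_sum_rpow_le_of_le {ι : Type*} {A : Finset ι} {ρ : ι → ℝ} {p L c B τ : ℝ}
    (hL : 0 < L) (hc : 0 ≤ c) (hτ : 0 ≤ τ) (hp0 : 0 ≤ p) (hp1 : p < 1) (hρ : ∀ i ∈ A, 0 ≤ ρ i)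
    (hρτ : ∀ i ∈ A, ρ i ≤ τ * L) (hlow : L ≤ c * ∑ i ∈ A, ρ i)
    (hB : ∑ i ∈ A, ρ i ^ p ≤ B * L ^ p) : 1 ≤ c * B * τ ^ (1 - p) := by
  have h1 : ∑ i ∈ A, ρ i ≤ (τ * L) ^ (1 - p) * ∑ i ∈ A, ρ i ^ p := by
    rw [Finset.mul_sum]
    refine Finset.sum_le_sum fun i hi => ?_
    calc ρ i = ρ i ^ (1 - p) * ρ i ^ p := by
          rw [← Real.rpow_add_of_nonneg (hρ i hi) (by linarith) hp0]; simp
      _ ≤ _ := mul_le_mul_of_nonneg_right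
          (Real.rpow_le_rpow (hρ i hi) (hρτ i hi) (by linarith)) (Real.rpow_nonneg (hρ i hi) _)
  have h3 : L ≤ c * ((τ * L) ^ (1 - p) * (B * L ^ p)) := by
    refine hlow.trans (mul_le_mul_of_nonneg_left (h1.trans ?_) hc)
    exact mul_le_mul_of_nonneg_left hB (by positivity)
  have h5 : L ^ (1 - p) * L ^ p = L := by rw [← Real.rpow_add hL]; simp
  refine le_of_mul_le_mul_right ?_ hL
  rw [Real.mul_rpow hτ hL.le] at h3
  calc 1 * L ≤ _ := (one_mul L).le.trans h3
    _ = c * B * τ ^ (1 - p) * (L ^ (1 - p) * L ^ p) := by ring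
    _ = _ := by rw [h5]

/-- Hölder costs `N ^ ((m + 1) * (p - 1))` against the lower bound `N ^ (m * p)`; the quotient is `N
^ (m + 1 - p)`. -/
theorem rpow_le_of_sum_rpow_le {ι : Type*} {A : Finset ι} {ρ : ι → ℝ} {m N : ℕ} {p L c B : ℝ}
    (hN : 0 < N) (hA : A.card = N ^ (m + 1)) (hL : 0 < L) (hc : 0 ≤ c) (hp : 1 ≤ p)
    (hρ : ∀ i ∈ A, 0 ≤ ρ i) (hlow : (N : ℝ) ^ m * L ≤ c * ∑ i ∈ A, ρ i)
    (hB : ∑ i ∈ A, ρ i ^ p ≤ B * L ^ p) : (N : ℝ) ^ (((m + 1 : ℕ) : ℝ) - p) ≤ c ^ p * B := by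
  have hN' : (0 : ℝ) < N := by exact_mod_cast hN
  have h1 := Real.rpow_sum_le_const_mul_sum_rpow A ρ hp
  rw [Finset.sum_congr rfl fun i hi => abs_of_nonneg (hρ i hi),
    Finset.sum_congr rfl fun i hi => congrArg (· ^ p) (abs_of_nonneg (hρ i hi)), hA] at h1
  have h2 : ((N : ℝ) ^ m * L) ^ p ≤ c ^ p * (((N ^ (m + 1) : ℕ) : ℝ) ^ (p - 1) * (B * L ^ p)) := by
    refine (Real.rpow_le_rpow (by positivity) hlow (by linarith)).trans ?_
    rw [Real.mul_rpow hc (Finset.sum_nonneg hρ)]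
    exact mul_le_mul_of_nonneg_left (h1.trans (mul_le_mul_of_nonneg_left hB (by positivity)))
      (by positivity)
  rw [Real.mul_rpow (by positivity) hL.le, Nat.cast_pow, ← Real.rpow_natCast,
    ← Real.rpow_natCast, ← Real.rpow_mul hN'.le, ← Real.rpow_mul hN'.le] at h2
  have h3 : (N : ℝ) ^ (((m + 1 : ℕ) : ℝ) - p) * (N : ℝ) ^ (((m + 1 : ℕ) : ℝ) * (p - 1)) =
      (N : ℝ) ^ ((m : ℝ) * p) := by
    rw [← Real.rpow_add hN']
    congr 1
    push_cast
    ring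
  rw [← h3] at h2
  have h4 : 0 < (N : ℝ) ^ (((m + 1 : ℕ) : ℝ) * (p - 1)) * L ^ p := by positivity
  refine le_of_mul_le_mul_right ?_ h4
  linarith

/-- The length-volume argument: a metric space that contains quasi-symmetric images of
arbitrarily large `d`-dimensional grids has no Assouad exponent below `d`. -/
theorem le_of_isAssouadExponent_of_hasLargeGrids {X Y : Type*} [MetricSpace X] [MetricSpace Y]
    {d : ℕ} {F : Set X} (hF : HasLargeGrids d F) {f : F → Y} (hf : IsQuasisymmetric f) {s : ℝ≥0}
    (hs : IsAssouadExponent (range f) s) : (d : ℝ) ≤ s := by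
  by_contra! hsd
  obtain _ | m := d
  · exact absurd hsd (by simp)
  obtain ⟨hemb, η, hη⟩ := hf
  obtain ⟨K, hK⟩ := hF
  choose x δ hδ hx using hK
  -- replace `s` by a larger positive exponent, which exceeds `1` when `m ≥ 1`
  obtain ⟨s', hss', hs'd, hs'0, hs'1⟩ : ∃ s' : ℝ≥0, s ≤ s' ∧ (s' : ℝ) < (m + 1 : ℕ) ∧ 0 < s' ∧
      (m ≠ 0 → 1 ≤ s') := by
    rcases Nat.eq_zero_or_pos m with rfl | hm
    · refine ⟨max s (1 / 2), le_max_left _ _, ?_, lt_max_of_lt_right (by norm_num), by simp⟩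
      rw [NNReal.coe_max]
      exact max_lt hsd (by norm_num)
    · refine ⟨max s 1, le_max_left _ _, ?_, lt_max_of_lt_right one_pos, fun _ => le_max_right _ _⟩
      rw [NNReal.coe_max]
      refine max_lt hsd ?_
      have : (1 : ℝ) ≤ m := by exact_mod_cast hm
      push_cast
      linarith
  obtain ⟨C, hC, hexp⟩ := hs.mono hss'
  obtain ⟨p, hsp, hpd⟩ := exists_between hs'd
  have hs'0' : (0 : ℝ) < s' := by exact_mod_cast hs'0
  have hp0 : 0 < p := hs'0'.trans hsp
  set H : ℝ := η K + 1 with hHdef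
  have hH1 : 1 ≤ H := by simp [hHdef]
  have hH0 : 0 < H := by linarith
  set y : ℕ → (Fin (m + 1) → ℕ) → Y := fun N g => f (x N g)
  have hyH : ∀ N, IsWeaklyQuasisymmetricOnGrid N H (y N) := by
    intro N g a c hg ha hc h
    have := dist_quasisymmetric_grid_le hη (hδ N) (hx N) hg ha hc (t := 1) (by simpa using h)
    rw [mul_one] at this
    refine this.trans (mul_le_mul_of_nonneg_right ?_ dist_nonneg)
    simp [hHdef]
  have hL : ∀ N : ℕ, 0 < N → 0 < gridSpan N (y N) := by
    intro N hN
    refine dist_pos.2 fun h => ?_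
    have h1 := (hx N 0 (Fin.cons N 0) (fun i => Nat.zero_le _)
      (cons_le le_rfl fun i => Nat.zero_le _)).1
    rw [hemb.injective h, dist_self] at h1
    have h2 : (1 : ℝ) ≤ dist (0 : Fin (m + 1) → ℕ) (Fin.cons N 0 : Fin (m + 1) → ℕ) := by
      refine one_le_dist_of_ne fun h => ?_
      have := congrFun h 0
      simp only [Pi.zero_apply, Fin.cons_zero] at this
      omega
    nlinarith [hδ N]
  -- It is essential that `B` depends only on `C`, `H`, `s'` and `p`, not on `N`.
  obtain ⟨B, hB0, hB⟩ : ∃ B : ℝ, 0 ≤ B ∧ ∀ N : ℕ, 0 < N →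
      ∑ q ∈ edgeIndex m N, edgeLength (y N) q ^ p ≤ B * gridSpan N (y N) ^ p := by
    refine ⟨_, ?_, fun N hN => sum_rpow_le_of_card_le
      (mul_pos hC (Real.rpow_pos_of_pos (by positivity : 0 < 4 * H ^ 2) s')) (hL N hN) hs'0' hsp _ _
      (fun q _ => dist_nonneg)
      (fun r hr A hA hrA => card_edges_le hH1 (hyH N) (hL N hN)
        (Z := range f) (fun g => mem_range_self _) hC hexp
        hr hA hrA)⟩
    exact mul_nonneg (by positivity) (tsum_nonneg fun n => by positivity)
  have hlow := fun N => pow_mul_gridSpan_le_sum hH0.le (hyH N)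
  rcases Nat.eq_zero_or_pos m with rfl | hm
  · have hp1 : p < 1 := by simpa using hpd
    have hθ : ∀ N : ℕ, 0 < N → ∀ q ∈ edgeIndex 0 N, edgeLength (y N) q ≤
        η (K * (2 / N)) * (2 * H * gridSpan N (y N)) := by
      intro N hN q hq
      refine edgeLength_le_mul_gridSpan (NNReal.coe_nonneg _) (hyH N) ?_ hq
      intro g a c hg ha hc h
      refine dist_quasisymmetric_grid_le hη (hδ N) (hx N) hg ha hc ?_
      have hN' : (0 : ℝ) < N := by exact_mod_cast hN
      push_cast
      rw [div_mul_eq_mul_div, le_div_iff₀ hN']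
      linarith
    have hbound : ∀ N : ℕ, 0 < N → 1 ≤ 2 * H * B *
        ((η (K * (2 / N)) : ℝ) * (2 * H)) ^ (1 - p) := by
      intro N hN
      refine one_le_of_sum_rpow_le_of_le (ρ := edgeLength (y N)) (hL N hN) (by positivity)
        (by positivity) hp0.le hp1 (fun q _ => dist_nonneg) (fun q hq => ?_) (by simpa using hlow N) (hB N hN)
      rw [mul_assoc]
      exact hθ N hN q hq
    have hlim : Tendsto (fun N : ℕ => 2 * H * B *
        ((η (K * (2 / N)) : ℝ) * (2 * H)) ^ (1 - p)) atTop (𝓝 0) := by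
      have h2 := tendsto_homeomorph_nnreal_div η K
      have h3 := ((h2.mul_const (2 * H)).rpow_const (p := 1 - p) (Or.inr (by linarith))).const_mul
        (2 * H * B)
      simpa [Real.zero_rpow (by linarith : 1 - p ≠ 0)] using h3
    have := ge_of_tendsto hlim ((eventually_gt_atTop 0).mono hbound)
    linarith
  · have hp1 : 1 ≤ p := by
      have : (1 : ℝ) ≤ s' := by exact_mod_cast hs'1 hm.ne'
      linarith
    have hbound : ∀ N : ℕ, 0 < N → (N : ℝ) ^ (((m + 1 : ℕ) : ℝ) - p) ≤ (2 * H) ^ p * B :=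
      fun N hN => rpow_le_of_sum_rpow_le hN (card_edgeIndex m N) (hL N hN) (by positivity) hp1
        (fun q _ => dist_nonneg) (hlow N) (hB N hN)
    have hlim : Tendsto (fun N : ℕ => (N : ℝ) ^ (((m + 1 : ℕ) : ℝ) - p)) atTop atTop :=
      (tendsto_rpow_atTop (by linarith)).comp tendsto_natCast_atTop_atTop
    obtain ⟨N, hN, hN0⟩ := ((hlim.eventually_gt_atTop ((2 * H) ^ p * B)).and
      (eventually_gt_atTop 0)).exists
    exact absurd (hbound N hN0) (not_le.2 hN)

theorem le_conformalAssouadDim_of_hasLargeGrids {X : Type*} [MetricSpace X] {d : ℕ} {F : Set X}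
    (hF : HasLargeGrids d F) : (d : ℝ≥0∞) ≤ conformalAssouadDim F := by
  refine le_iInf fun Y => le_iInf fun _ => le_iInf fun f => le_iInf fun hf => le_iInf fun s =>
    le_iInf fun hs => ?_
  have := le_of_isAssouadExponent_of_hasLargeGrids hF hf hs
  exact_mod_cast this

theorem conformalAssouadDim_le_assouadDim {X : Type*} [MetricSpace X] (F : Set X) :
    conformalAssouadDim F ≤ assouadDim F := by
  refine iInf₂_le_of_le X inferInstance (iInf₂_le_of_le (Subtype.val : F → X) ?_ ?_)
  · exact ⟨IsEmbedding.subtypeVal, Homeomorph.refl _, fun x a b t h => h⟩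
  · rw [Subtype.range_coe]

/-! ### Coordinate cubes and upper bounds for the Assouad dimension -/

/-- `F` is relatively dense in balls: for every `ε` some ball of radius `R` has all its points
within `ε R` of `F`. -/
def IsAlmostDenseInBalls {X : Type*} [MetricSpace X] (F : Set X) : Prop :=
  ∀ ε : ℝ, 0 < ε → ∃ (x : X) (R : ℝ), 0 < R ∧ ∀ y ∈ Metric.closedBall x R, ∃ z ∈ F,
    dist y z ≤ ε * R

theorem exists_lt_mul_div_le_le {u ℓ : ℝ} {N : ℕ} (hN : 0 < N) (hℓ : 0 < ℓ) (hu0 : 0 ≤ u)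
    (huℓ : u ≤ ℓ) : ∃ k : Fin N, (k : ℝ) * (ℓ / N) ≤ u ∧ u ≤ (k : ℝ) * (ℓ / N) + ℓ / N := by
  have hN' : (0 : ℝ) < N := by exact_mod_cast hN
  have hc : 0 < ℓ / N := by positivity
  -- At the closed upper end the floor would be `N`, so the last piece is taken instead.
  rcases huℓ.eq_or_lt with rfl | hlt
  · refine ⟨⟨N - 1, by omega⟩, ?_, ?_⟩
    · have : ((N - 1 : ℕ) : ℝ) ≤ N := by exact_mod_cast Nat.sub_le N 1
      calc ((N - 1 : ℕ) : ℝ) * (u / N) ≤ N * (u / N) := by gcongr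
        _ = u := by field_simp
    · rw [Nat.cast_sub hN]
      refine le_of_eq ?_
      push_cast
      field_simp
      ring
  · have hv : 0 ≤ u / (ℓ / N) := by positivity
    refine ⟨⟨⌊u / (ℓ / N)⌋₊, (Nat.floor_lt hv).2 ?_⟩, ?_, ?_⟩
    · rw [div_lt_iff₀ hc]
      calc u < ℓ := hlt
        _ = N * (ℓ / N) := by field_simp
    · exact (le_div_iff₀ hc).1 (Nat.floor_le hv)
    · have := (div_le_iff₀ hc).1 (Nat.lt_floor_add_one (u / (ℓ / N))).le
      simp only
      linarith

section Cubes

variable {X : Type*} [NormedAddCommGroup X] [NormedSpace ℝ X] {d : ℕ}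
  (b : Module.Basis (Fin d) ℝ X)

/-- The closed cube with side length `ℓ` and lowest corner `a`, in coordinates with respect to
`b`. -/
def cube (a : Fin d → ℝ) (ℓ : ℝ) : Set X :=
  {x | ∀ i, a i ≤ b.equivFunL x i ∧ b.equivFunL x i ≤ a i + ℓ}

theorem exists_bilipschitz_coordinates : ∃ K : ℝ, 1 ≤ K ∧
    (∀ x y : X, dist (b.equivFunL x) (b.equivFunL y) ≤ K * dist x y) ∧
    ∀ x y : X, dist x y ≤ K * dist (b.equivFunL x) (b.equivFunL y) := by
  refine ⟨1 + ‖(b.equivFunL : X →L[ℝ] Fin d → ℝ)‖ + ‖(b.equivFunL.symm : (Fin d → ℝ) →L[ℝ] X)‖,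
    ?_, fun x y => ?_, fun x y => ?_⟩
  · linarith [norm_nonneg (b.equivFunL : X →L[ℝ] Fin d → ℝ),
      norm_nonneg (b.equivFunL.symm : (Fin d → ℝ) →L[ℝ] X)]
  · refine ((b.equivFunL : X →L[ℝ] Fin d → ℝ).dist_le_opNorm x y).trans ?_
    gcongr
    linarith [norm_nonneg (b.equivFunL.symm : (Fin d → ℝ) →L[ℝ] X)]
  · have h := (b.equivFunL.symm : (Fin d → ℝ) →L[ℝ] X).dist_le_opNorm
      (b.equivFunL x) (b.equivFunL y)
    simp only [ContinuousLinearEquiv.coe_coe, ContinuousLinearEquiv.symm_apply_apply] at h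
    refine h.trans ?_
    gcongr
    linarith [norm_nonneg (b.equivFunL : X →L[ℝ] Fin d → ℝ)]

variable {b}

theorem dist_le_of_mem_cube {K : ℝ} (hK : 0 ≤ K)
    (hb : ∀ x y : X, dist x y ≤ K * dist (b.equivFunL x) (b.equivFunL y)) {a : Fin d → ℝ} {ℓ : ℝ}
    (hℓ : 0 ≤ ℓ) {x y : X} (hx : x ∈ cube b a ℓ) (hy : y ∈ cube b a ℓ) : dist x y ≤ K * ℓ := by
  refine (hb x y).trans (mul_le_mul_of_nonneg_left ((dist_pi_le_iff hℓ).2 fun i => ?_) hK)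
  rw [Real.dist_eq, abs_le]
  constructor <;> linarith [hx i, hy i]

theorem closedBall_subset_cube {K : ℝ}
    (hb : ∀ x y : X, dist (b.equivFunL x) (b.equivFunL y) ≤ K * dist x y) (hK : 0 ≤ K) (x : X)
    {R ℓ : ℝ} (hℓ : 2 * (K * R) ≤ ℓ) :
    Metric.closedBall x R ⊆ cube b (fun i => b.equivFunL x i - ℓ / 2) ℓ := by
  intro y hy i
  have h1 := (dist_le_pi_dist _ _ i).trans ((hb y x).trans
    (mul_le_mul_of_nonneg_left (Metric.mem_closedBall.1 hy) hK))
  rw [Real.dist_eq, abs_le] at h1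
  constructor <;> linarith

/-- The lowest corners of the `N ^ d` cubes into which a cube is divided. -/
noncomputable def subcorner (N : ℕ) (a : Fin d → ℝ) (ℓ : ℝ) (k : Fin d → Fin N) : Fin d → ℝ :=
  fun i => a i + (k i : ℝ) * (ℓ / N)

theorem exists_mem_subcube {N : ℕ} (hN : 0 < N) {a : Fin d → ℝ} {ℓ : ℝ} (hℓ : 0 < ℓ) {x : X}
    (hx : x ∈ cube b a ℓ) : ∃ k : Fin d → Fin N, x ∈ cube b (subcorner N a ℓ k) (ℓ / N) := by
  have h : ∀ i, ∃ k : Fin N, (k : ℝ) * (ℓ / N) ≤ b.equivFunL x i - a i ∧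
      b.equivFunL x i - a i ≤ (k : ℝ) * (ℓ / N) + ℓ / N := fun i =>
    exists_lt_mul_div_le_le hN hℓ (by linarith [hx i]) (by linarith [hx i])
  choose k hk using h
  refine ⟨k, fun i => ?_⟩
  simp only [subcorner]
  constructor <;> linarith [hk i]

theorem exists_finset_cover_cube_pow {N M : ℕ} (hN : 0 < N) {F : Set X}
    (h : ∀ (a : Fin d → ℝ) (ℓ : ℝ), 0 < ℓ → ∃ S : Finset (Fin d → ℝ), S.card ≤ M ∧
      cube b a ℓ ∩ F ⊆ ⋃ c ∈ S, cube b c (ℓ / N)) (n : ℕ) (a : Fin d → ℝ) {ℓ : ℝ} (hℓ : 0 < ℓ) :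
    ∃ S : Finset (Fin d → ℝ), S.card ≤ M ^ n ∧ cube b a ℓ ∩ F ⊆ ⋃ c ∈ S, cube b c (ℓ / N ^ n) := by
  induction n with
  | zero => exact ⟨{a}, by simp, by simp⟩
  | succ n ih =>
    classical
    obtain ⟨S, hS, hcov⟩ := ih
    choose T hT hTcov using fun c => h c (ℓ / N ^ n) (by positivity)
    refine ⟨S.biUnion T, ?_, fun x hx => ?_⟩
    · rw [pow_succ]
      exact (Finset.card_biUnion_le_card_mul S T M fun c _ => hT c).trans
        (Nat.mul_le_mul_right M hS)
    · obtain ⟨c, hc, hxc⟩ := mem_iUnion₂.1 (hcov hx)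
      obtain ⟨c', hc', hxc'⟩ := mem_iUnion₂.1 (hTcov c ⟨hxc, hx.2⟩)
      rw [div_div, ← pow_succ] at hxc'
      exact mem_iUnion₂.2 ⟨c', Finset.mem_biUnion.2 ⟨c, hc, hc'⟩, hxc'⟩

/-- If every cube can be divided by `N` such that at most `M = N ^ s` subcubes are needed to cover
`F`, then `s` is an Assouad exponent of `F`. -/
theorem isAssouadExponent_of_cover_cube {N M : ℕ} (hN : 2 ≤ N) {s : ℝ≥0}
    (hs : (N : ℝ) ^ (s : ℝ) = M) {F : Set X}
    (h : ∀ (a : Fin d → ℝ) (ℓ : ℝ), 0 < ℓ → ∃ S : Finset (Fin d → ℝ), S.card ≤ M ∧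
      cube b a ℓ ∩ F ⊆ ⋃ c ∈ S, cube b c (ℓ / N)) : IsAssouadExponent F s := by
  obtain ⟨K, hK1, hb1, hb2⟩ := exists_bilipschitz_coordinates b
  have hK0 : 0 < K := by linarith
  have hN1 : (1 : ℝ) < N := by exact_mod_cast hN
  have hN0 : (0 : ℝ) < N := by linarith
  refine ⟨(4 * K ^ 2 * N) ^ (s : ℝ), by positivity, fun R hR r hr hrR x _ => ?_⟩
  have hz : 1 ≤ 4 * K ^ 2 * (R / r) := by
    have h1 : 1 ≤ R / r := (one_le_div hr).2 hrR.le
    nlinarith [mul_self_nonneg (K - 1)]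
  -- Subdividing `n + 1` times brings the cube diameter below `r / 2`, and minimality of the depth
  -- costs only one extra factor `N`.
  obtain ⟨n, hn1, hn2⟩ := exists_nat_pow_near hz hN1
  obtain ⟨S, hS, hcov⟩ := exists_finset_cover_cube_pow (by omega) h (n + 1)
    (fun i => b.equivFunL x i - (2 * (K * R)) / 2) (ℓ := 2 * (K * R)) (by positivity)
  set ℓ := 2 * (K * R) / (N : ℝ) ^ (n + 1) with hℓ
  have hℓ0 : 0 < ℓ := by positivity
  have hℓr : K * ℓ ≤ r / 2 := by
    rw [hℓ, mul_div_assoc', div_le_iff₀ (by positivity)]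
    have : 4 * K ^ 2 * R < (N : ℝ) ^ (n + 1) * r := by
      rwa [mul_div_assoc', div_lt_iff₀ hr] at hn2
    nlinarith
  have hcard : coverNumber r (Metric.closedBall x R ∩ F) ≤ S.card := by
    -- Thickening by `r / 4` makes the cubes open and raises the diameter to at most `r`.
    refine coverNumber_le_of_finset S (fun c => Metric.thickening (r / 4) (cube b c ℓ))
      (fun c _ => Metric.isOpen_thickening) (fun c _ => ?_) ?_
    · refine Metric.ediam_le fun y hy z hz => ?_
      obtain ⟨y', hy', hyy'⟩ := Metric.mem_thickening_iff.1 hy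
      obtain ⟨z', hz', hzz'⟩ := Metric.mem_thickening_iff.1 hz
      rw [edist_dist]
      refine ENNReal.ofReal_le_ofReal ?_
      have h1 := dist_le_of_mem_cube hK0.le hb2 hℓ0.le hy' hz'
      have h2 := dist_triangle4_right y z y' z'
      linarith
    · intro y hy
      obtain ⟨c, hc, hyc⟩ := mem_iUnion₂.1
        (hcov ⟨closedBall_subset_cube hb1 hK0.le x le_rfl hy.1, hy.2⟩)
      exact mem_iUnion₂.2 ⟨c, hc, Metric.self_subset_thickening (by positivity) _ hyc⟩
  refine (ENat.toENNReal_le.2 hcard).trans ?_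
  rw [ENat.toENNReal_coe, ← ENNReal.ofReal_natCast]
  refine ENNReal.ofReal_le_ofReal ?_
  calc (S.card : ℝ) ≤ (M : ℝ) ^ (n + 1) := by exact_mod_cast hS
    _ = ((N : ℝ) ^ (n + 1)) ^ (s : ℝ) := by
      rw [← hs, ← Real.rpow_natCast, ← Real.rpow_natCast, ← Real.rpow_mul hN0.le,
        ← Real.rpow_mul hN0.le, mul_comm]
    _ ≤ (4 * K ^ 2 * (R / r) * N) ^ (s : ℝ) := by
      refine Real.rpow_le_rpow (by positivity) ?_ s.coe_nonneg
      rw [pow_succ]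
      gcongr
    _ = _ := by
      rw [← Real.mul_rpow (by positivity) (by positivity)]
      congr 1
      ring

theorem assouadDim_le_finrank (b : Module.Basis (Fin d) ℝ X) (F : Set X) : assouadDim F ≤ d := by
  classical
  have h : IsAssouadExponent F (d : ℝ≥0) := by
    refine isAssouadExponent_of_cover_cube (b := b) (N := 2) (M := 2 ^ d) le_rfl (by simp) ?_
    intro a ℓ hℓ
    refine ⟨Finset.univ.image (subcorner 2 a ℓ), Finset.card_image_le.trans (by simp), ?_⟩
    intro x hx
    obtain ⟨k, hk⟩ := exists_mem_subcube two_pos hℓ hx.1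
    exact mem_iUnion₂.2 ⟨_, Finset.mem_image_of_mem _ (Finset.mem_univ k), hk⟩
  simpa using assouadDim_le h

/-- A set of full Assouad dimension is not uniformly porous. -/
theorem isAlmostDenseInBalls_of_assouadDim_eq (b : Module.Basis (Fin d) ℝ X) {F : Set X}
    (hF : F.Nonempty) (hdim : assouadDim F = d) : IsAlmostDenseInBalls F := by
  classical
  -- For `d = 0` the count `N ^ d - 1` vanishes and has no usable logarithm, but `X` is a point.
  obtain rfl | hd := Nat.eq_zero_or_pos d
  · obtain ⟨z, hz⟩ := hF
    intro ε hε
    have : Subsingleton X := b.equivFunL.injective.subsingleton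
    refine ⟨z, 1, one_pos, fun y _ => ⟨z, hz, ?_⟩⟩
    rw [Subsingleton.elim y z, dist_self]
    positivity
  by_contra hnot
  simp only [IsAlmostDenseInBalls, not_forall] at hnot
  obtain ⟨ε, hε, hnot⟩ := hnot
  push Not at hnot
  obtain ⟨K, hK1, hb1, hb2⟩ := exists_bilipschitz_coordinates b
  have hK0 : 0 < K := by linarith
  -- A subcube has diameter at most `K * (ℓ / N)`, which must not exceed the hole radius `ε * (ℓ /
  -- (2 * K))`; hence `2 * K ^ 2 ≤ ε * N`.
  obtain ⟨N, hN⟩ := exists_nat_ge (2 + 2 * K ^ 2 / ε)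
  have hN2 : (2 : ℝ) ≤ N := le_trans (by linarith [show 0 ≤ 2 * K ^ 2 / ε by positivity]) hN
  have hNε : 2 * K ^ 2 ≤ ε * N := by
    have : 2 * K ^ 2 / ε ≤ N := by linarith
    rwa [div_le_iff₀' hε] at this
  have hN2' : 2 ≤ N := by exact_mod_cast hN2
  have hN0 : (0 : ℝ) < N := by linarith
  have hpow : 2 ≤ N ^ d := hN2'.trans (Nat.le_self_pow hd.ne' N)
  have hM0 : (1 : ℝ) ≤ ((N ^ d - 1 : ℕ) : ℝ) := by
    have : 1 ≤ N ^ d - 1 := by omega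
    exact_mod_cast this
  set s : ℝ≥0 := (Real.logb N ((N ^ d - 1 : ℕ) : ℝ)).toNNReal
  have hs : (s : ℝ) = Real.logb N ((N ^ d - 1 : ℕ) : ℝ) :=
    Real.coe_toNNReal _ (Real.logb_nonneg (by linarith) hM0)
  have hNs : (N : ℝ) ^ (s : ℝ) = ((N ^ d - 1 : ℕ) : ℝ) := by
    rw [hs, Real.rpow_logb hN0 (by linarith) (by linarith)]
  have hexp : IsAssouadExponent F s := by
    refine isAssouadExponent_of_cover_cube (b := b) hN2' hNs fun a ℓ hℓ => ?_
    obtain ⟨y, hy, hhole⟩ := hnot (b.equivFunL.symm fun i => a i + ℓ / 2) (ℓ / (2 * K))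
      (by positivity)
    have hy' : y ∈ cube b a ℓ := by
      have := closedBall_subset_cube hb1 hK0.le _ (ℓ := ℓ) (le_of_eq (by field_simp)) hy
      simpa only [ContinuousLinearEquiv.apply_symm_apply, add_sub_cancel_right] using this
    obtain ⟨k₀, hk₀⟩ := exists_mem_subcube (N := N) (by omega) hℓ hy'
    refine ⟨(Finset.univ.erase k₀).image (subcorner N a ℓ), Finset.card_image_le.trans ?_, ?_⟩
    · rw [Finset.card_erase_of_mem (Finset.mem_univ _)]
      simp
    · intro x hx
      obtain ⟨k, hk⟩ := exists_mem_subcube (N := N) (by omega) hℓ hx.1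
      refine mem_iUnion₂.2 ⟨_, Finset.mem_image_of_mem _
        (Finset.mem_erase.2 ⟨?_, Finset.mem_univ k⟩), hk⟩
      rintro rfl
      have h1 := dist_le_of_mem_cube hK0.le hb2 (by positivity) hk₀ hk
      have h2 := hhole x hx.2
      refine absurd (h2.trans_le h1) (not_lt.2 ?_)
      rw [mul_div_assoc', mul_div_assoc', div_le_div_iff₀ hN0 (by positivity)]
      nlinarith
  have hlt : (s : ℝ) < d := by
    rw [← Real.rpow_lt_rpow_left_iff (x := (N : ℝ)) (by linarith), hNs, Real.rpow_natCast]
    have : N ^ d - 1 < N ^ d := by omega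
    exact_mod_cast this
  have h1 := assouadDim_le hexp
  rw [hdim] at h1
  have h2 : (d : ℝ≥0) ≤ s := by exact_mod_cast h1
  exact absurd hlt (not_lt.2 (by exact_mod_cast h2))

end Cubes

/-! ### Patches, the Steinhaus property and weak tangents -/

section Tangents

variable {X : Type*} [NormedAddCommGroup X] [NormedSpace ℝ X] {d : ℕ}
  {b : Module.Basis (Fin d) ℝ X} {F : Set X}

/-- If `P` has norms at most `M`, scaling by `R / M` fits it into a ball of radius `R`; relative
density `ε / M` there is exactly the error `ε * δ`. -/
theorem asymptoticSteinhaus_of_isAlmostDenseInBalls (h : IsAlmostDenseInBalls F) :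
    AsymptoticSteinhaus F := by
  intro P hP ε hε
  obtain ⟨M, hM0, hM⟩ := hP.isBounded.exists_pos_norm_le
  obtain ⟨x, R, hR, hx⟩ := h (ε / M) (by positivity)
  have hεδ : ε / M * R = ε * (R / M) := by ring
  rw [hεδ] at hx
  refine ⟨R / M, by positivity, x,
    {z | z ∈ F ∧ ∃ p ∈ P, dist z (x + (R / M) • p) ≤ ε * (R / M)}, fun z hz => hz.1, ?_⟩
  refine Metric.hausdorffEDist_le_of_mem_edist ?_ ?_
  · rintro z ⟨-, p, hp, hzp⟩
    refine ⟨_, mem_image_of_mem _ hp, ?_⟩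
    rw [edist_dist]
    exact ENNReal.ofReal_le_ofReal hzp
  · rintro _ ⟨p, hp, rfl⟩
    obtain ⟨z, hz, hzp⟩ := hx (x + (R / M) • p) (by
      rw [Metric.mem_closedBall, dist_self_add_left, norm_smul, Real.norm_of_nonneg (by positivity),
        div_mul_eq_mul_div, div_le_iff₀ hM0]
      exact mul_le_mul_of_nonneg_left (hM p hp) hR.le)
    refine ⟨z, ⟨hz, p, hp, by rwa [dist_comm]⟩, ?_⟩
    rw [edist_dist]
    exact ENNReal.ofReal_le_ofReal hzp

theorem patch_eq_image (b : Module.Basis (Fin d) ℝ X) (k : ℕ) (δ : ℝ) (t : X) :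
    patch b k δ t = (fun p => t + δ • p) '' patch b k 1 0 := by
  ext p
  constructor
  · rintro ⟨x, hx, rfl⟩
    exact ⟨_, ⟨x, hx, rfl⟩, by simp⟩
  · rintro ⟨_, ⟨x, hx, rfl⟩, rfl⟩
    exact ⟨x, hx, by simp⟩

theorem finite_patch (b : Module.Basis (Fin d) ℝ X) (k : ℕ) (δ : ℝ) (t : X) :
    (patch b k δ t).Finite := by
  refine ((Fintype.piFinset fun _ : Fin d => Finset.range k).finite_toSet.image
    fun x => t + δ • ∑ i, (x i : ℝ) • b i).subset ?_
  rintro _ ⟨x, hx, rfl⟩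
  exact ⟨x, by simpa using hx, rfl⟩

theorem AsymptoticSteinhaus.asymptoticallyContainsPatches (b : Module.Basis (Fin d) ℝ X)
    (h : AsymptoticSteinhaus F) : AsymptoticallyContainsPatches b F := by
  intro k ε hε
  obtain ⟨δ, hδ, t, E, hE, hd⟩ := h (patch b k 1 0) (finite_patch b k 1 0) ε hε
  exact ⟨δ, hδ, t, E, hE, by rwa [patch_eq_image]⟩

theorem dist_equivFunL_sum_natCast (b : Module.Basis (Fin d) ℝ X) (g h : Fin d → ℕ) :
    dist (b.equivFunL (∑ i, (g i : ℝ) • b i)) (b.equivFunL (∑ i, (h i : ℝ) • b i)) = dist g h := by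
  have hc : ∀ g : Fin d → ℕ, b.equivFunL (∑ i, (g i : ℝ) • b i) = fun i => (g i : ℝ) := by
    intro g
    ext j
    simp [Finsupp.single_apply]
  rw [hc, hc, dist_pi_def, dist_pi_def]
  simp only [← Nat.dist_cast_real, nndist_dist]

/-- Sets with similar copies containing good approximations of large patches contain large
grids. -/
theorem hasLargeGrids_of_approx (b : Module.Basis (Fin d) ℝ X)
    (h : ∀ ε : ℝ, 0 < ε → ∀ N : ℕ, ∃ (T : Dilation X X) (δ : ℝ) (t : X) (x : (Fin d → ℕ) → F),
      0 < δ ∧ ∀ g : Fin d → ℕ, (∀ i, g i ≤ N) →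
        dist (t + δ • ∑ i, (g i : ℝ) • b i) (T (x g)) ≤ ε * δ) : HasLargeGrids d F := by
  obtain ⟨K, hK1, hb1, hb2⟩ := exists_bilipschitz_coordinates b
  have hK0 : 0 < K := by linarith
  refine ⟨(4 * K ^ 2).toNNReal, fun N => ?_⟩
  -- Distinct patch points are at least `δ / K` apart, so the two errors of `δ / (4 * K)` use up at
  -- most half of any distance.
  obtain ⟨T, δ, t, x, hδ, hx⟩ := h (1 / (4 * K)) (by positivity) N
  set c : ℝ := ((Dilation.ratio T : ℝ≥0) : ℝ)
  have hc0 : 0 < c := Dilation.ratio_pos T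
  refine ⟨x, δ / (2 * K) / c, by positivity, fun g h hg hh => ?_⟩
  rcases eq_or_ne g h with rfl | hne
  · simp
  rw [Real.coe_toNNReal _ (by positivity)]
  have hD := one_le_dist_of_ne hne
  have h1 := hb1 (∑ i, (g i : ℝ) • b i) (∑ i, (h i : ℝ) • b i)
  have h2 := hb2 (∑ i, (g i : ℝ) • b i) (∑ i, (h i : ℝ) • b i)
  rw [dist_equivFunL_sum_natCast] at h1 h2
  have hT : dist (T (x g)) (T (x h)) = c * dist (x g) (x h) := Dilation.dist_eq T _ _
  have hp : dist (t + δ • ∑ i, (g i : ℝ) • b i) (t + δ • ∑ i, (h i : ℝ) • b i) =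
      δ * dist (∑ i, (g i : ℝ) • b i) (∑ i, (h i : ℝ) • b i) := by
    rw [dist_add_left, dist_smul₀, Real.norm_of_nonneg hδ.le]
  have hxg := hx g hg
  have hxh := hx h hh
  set D := dist g h
  set Q := dist (∑ i, (g i : ℝ) • b i) (∑ i, (h i : ℝ) • b i)
  set pg := t + δ • ∑ i, (g i : ℝ) • b i
  set ph := t + δ • ∑ i, (h i : ℝ) • b i
  have h3 := dist_triangle4 pg (T (x g)) (T (x h)) ph
  have h4 := dist_triangle4 (T (x g)) pg ph (T (x h))
  rw [dist_comm (T (x h)) ph] at h3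
  rw [dist_comm (T (x g)) pg] at h4
  rw [hT, hp] at h3 h4
  have h5 : D / K ≤ Q := by rwa [div_le_iff₀' hK0]
  have h6 : 1 / (4 * K) * δ ≤ δ * (D / K) / 4 := by
    rw [show δ * (D / K) / 4 = 1 / (4 * K) * δ * D by field_simp]
    exact le_mul_of_one_le_right (by positivity) hD
  have h7 : δ * (D / K) ≤ δ * Q := by gcongr
  have h8 : δ * Q ≤ δ * (K * D) := by gcongr
  have h9 : D / K ≤ K * D := by linarith
  have h10 : δ * (D / K) ≤ δ * (K * D) := by gcongr
  constructor
  · rw [show δ / (2 * K) / c * D = δ * (D / K) / 2 / c by field_simp, div_le_iff₀' hc0]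
    linarith
  · rw [show 4 * K ^ 2 * (δ / (2 * K) / c * D) = 2 * (δ * (K * D)) / c by field_simp; ring,
      le_div_iff₀' hc0]
    have h11 : 0 ≤ δ * (K * D) := by positivity
    change c * dist (x g) (x h) ≤ _
    linarith

theorem exists_dist_lt_of_hausdorffEDist {α : Type*} [MetricSpace α] {A B : Set α} {r : ℝ} {a : α}
    (ha : a ∈ A) (h : Metric.hausdorffEDist A B < ENNReal.ofReal r) : ∃ y ∈ B, dist a y < r := by
  obtain ⟨y, hy, hay⟩ := Metric.exists_edist_lt_of_hausdorffEDist_lt ha h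
  refine ⟨y, hy, ?_⟩
  rw [edist_dist] at hay
  exact (ENNReal.ofReal_lt_ofReal_iff_of_nonneg dist_nonneg).1 hay

theorem AsymptoticallyContainsPatches.hasLargeGrids (hF : F.Nonempty)
    (h : AsymptoticallyContainsPatches b F) : HasLargeGrids d F := by
  refine hasLargeGrids_of_approx b fun ε hε N => ?_
  -- Size `N + 1` because the grid includes the value `N`; halving `ε` makes the Hausdorff bound
  -- strict, so that nearby points can be extracted.
  obtain ⟨δ, hδ, t, E, hE, hd⟩ := h (N + 1) (ε / 2) (by positivity)
  have hex : ∀ g : Fin d → ℕ, ∃ x : F, (∀ i, g i ≤ N) →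
      dist (t + δ • ∑ i, (g i : ℝ) • b i) x ≤ ε * δ := by
    intro g
    by_cases hg : ∀ i, g i ≤ N
    · rw [Metric.hausdorffEDist_comm] at hd
      have hmem : t + δ • ∑ i, (g i : ℝ) • b i ∈ patch b (N + 1) δ t :=
        ⟨g, fun i => Nat.lt_succ_of_le (hg i), rfl⟩
      obtain ⟨y, hy, hdy⟩ := exists_dist_lt_of_hausdorffEDist (r := ε * δ) hmem
        (hd.trans_lt ((ENNReal.ofReal_lt_ofReal_iff (by positivity)).2
          (by nlinarith [mul_pos hε hδ])))
      exact ⟨⟨y, hE hy⟩, fun _ => hdy.le⟩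
    · exact ⟨⟨_, hF.some_mem⟩, fun h => absurd h hg⟩
  choose x hx using hex
  exact ⟨Dilation.id X, δ, t, x, hδ, hx⟩

theorem hasLargeGrids_of_isWeakTangent (b : Module.Basis (Fin d) ℝ X) (hF : F.Nonempty) {E : Set X}
    (hE : IsWeakTangent E F) (hint : (interior E).Nonempty) : HasLargeGrids d F := by
  obtain ⟨-, -, T, hT⟩ := hE
  obtain ⟨z, hz⟩ := hint
  obtain ⟨ρ, hρ, hball⟩ := Metric.isOpen_iff.1 isOpen_interior z hz
  obtain ⟨K, hK1, -, hb2⟩ := exists_bilipschitz_coordinates b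
  refine hasLargeGrids_of_approx b fun ε hε N => ?_
  -- The patch then has radius at most `K * N * δ < ρ` and lies inside the interior of `E`.
  set δ := ρ / (K * N + 1)
  have hδ : 0 < δ := by positivity
  obtain ⟨n, hn⟩ := (hT.eventually_lt_const (ENNReal.ofReal_pos.2 (mul_pos hε hδ))).exists
  have hex : ∀ g : Fin d → ℕ, ∃ x : F, (∀ i, g i ≤ N) →
      dist (z + δ • ∑ i, (g i : ℝ) • b i) (T n x) ≤ ε * δ := by
    intro g
    by_cases hg : ∀ i, g i ≤ N
    · have hmem : z + δ • ∑ i, (g i : ℝ) • b i ∈ E := by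
        refine interior_subset (hball ?_)
        have h1 := hb2 (∑ i, (g i : ℝ) • b i) (∑ i, ((0 : Fin d → ℕ) i : ℝ) • b i)
        rw [dist_equivFunL_sum_natCast] at h1
        have h2 := dist_le_of_forall_le hg (fun i => Nat.zero_le N : ∀ i, (0 : Fin d → ℕ) i ≤ N)
        have h3 : ‖∑ i, (g i : ℝ) • b i‖ ≤ K * N := by
          refine le_trans ?_ (h1.trans (mul_le_mul_of_nonneg_left h2 (by linarith)))
          simp
        rw [Metric.mem_ball, dist_self_add_left, norm_smul, Real.norm_of_nonneg hδ.le]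
        calc δ * ‖∑ i, (g i : ℝ) • b i‖ ≤ δ * (K * N) := by gcongr
          _ < δ * (K * N + 1) := by gcongr; linarith
          _ = ρ := div_mul_cancel₀ _ (by positivity)
      obtain ⟨_, ⟨⟨x, hx, rfl⟩, -⟩, hdx⟩ := exists_dist_lt_of_hausdorffEDist hmem hn
      exact ⟨⟨x, hx⟩, fun _ => hdx.le⟩
    · exact ⟨⟨_, hF.some_mem⟩, fun h => absurd h hg⟩
  choose x hx using hex
  exact ⟨T n, δ, z, x, hδ, hx⟩

/-- The similarity that maps the ball of radius `R` about `x` to the unit ball. -/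
noncomputable def normalizingDilation (x : X) {R : ℝ} (hR : 0 < R) : Dilation X X :=
  Dilation.mkOfDistEq (fun y => R⁻¹ • (y - x)) ⟨R.toNNReal⁻¹, by simpa using hR, fun y z => by
    rw [dist_smul₀, dist_sub_right, norm_inv, Real.norm_of_nonneg hR.le, NNReal.coe_inv,
      Real.coe_toNNReal _ hR.le]⟩

theorem isWeakTangent_closedBall [ProperSpace X] (h : IsAlmostDenseInBalls F) :
    IsWeakTangent (Metric.closedBall (0 : X) 1) F := by
  refine ⟨isCompact_closedBall 0 1, subset_rfl, ?_⟩
  have hpos : ∀ n : ℕ, (0 : ℝ) < 1 / ((n : ℝ) + 1) := fun n => Nat.one_div_pos_of_nat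
  choose x R hR hx using fun n : ℕ => h (1 / ((n : ℝ) + 1)) (hpos n)
  refine ⟨fun n => normalizingDilation (x n) (hR n), ?_⟩
  have hlim : Tendsto (fun n : ℕ => ENNReal.ofReal (2 * (1 / ((n : ℝ) + 1)))) atTop (𝓝 0) := by
    have := ENNReal.tendsto_ofReal
      ((tendsto_one_div_add_atTop_nhds_zero_nat (𝕜 := ℝ)).const_mul 2)
    simpa using this
  refine tendsto_of_tendsto_of_tendsto_of_le_of_le tendsto_const_nhds hlim
    (fun n => zero_le) fun n => ?_
  set ε := 1 / ((n : ℝ) + 1)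
  have hε0 : 0 < ε := hpos n
  have hε1 : ε ≤ 1 := by
    have : (0 : ℝ) ≤ n := n.cast_nonneg
    exact (div_le_one (by positivity)).2 (by linarith)
  have hRn := hR n
  refine Metric.hausdorffEDist_le_of_mem_edist (fun w hw => ?_) fun w hw => ⟨w, hw.2, by simp⟩
  rw [mem_closedBall_zero_iff] at hw
  -- Shrinking `w` first keeps the approximating point inside the unit ball, at a total cost of `2 *
  -- ε`.
  have hw' : ‖(1 - ε) • w‖ ≤ 1 - ε := by
    rw [norm_smul, Real.norm_of_nonneg (by linarith)]
    exact mul_le_of_le_one_right (by linarith) hw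
  obtain ⟨z, hz, hzd⟩ := hx n (x n + R n • (1 - ε) • w) (by
    rw [Metric.mem_closedBall, dist_self_add_left, norm_smul, Real.norm_of_nonneg hRn.le]
    exact mul_le_of_le_one_right hRn.le (by linarith))
  have hTz : dist ((1 - ε) • w) ((R n)⁻¹ • (z - x n)) ≤ ε := by
    have h1 : (1 - ε) • w = (R n)⁻¹ • ((x n + R n • (1 - ε) • w) - x n) := by
      rw [add_sub_cancel_left, inv_smul_smul₀ hRn.ne']
    rw [h1, dist_smul₀, dist_sub_right, norm_inv, Real.norm_of_nonneg hRn.le,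
      inv_mul_le_iff₀ hRn, mul_comm]
    exact hzd
  refine ⟨(R n)⁻¹ • (z - x n), ⟨⟨z, hz, rfl⟩, ?_⟩, ?_⟩
  · rw [Metric.mem_closedBall, dist_comm]
    have h1 := dist_triangle 0 ((1 - ε) • w) ((R n)⁻¹ • (z - x n))
    rw [dist_zero_left ((1 - ε) • w)] at h1
    linarith
  · rw [edist_dist]
    refine ENNReal.ofReal_le_ofReal ?_
    have h1 := dist_triangle w ((1 - ε) • w) ((R n)⁻¹ • (z - x n))
    have h2 : dist w ((1 - ε) • w) ≤ ε := by
      rw [dist_eq_norm, sub_smul, one_smul, sub_sub_cancel, norm_smul, Real.norm_of_nonneg hε0.le]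
      exact mul_le_of_le_one_right hε0.le hw
    linarith

end Tangents

end AssouadPatch

theorem mainTheorem1 {X : Type*} [NormedAddCommGroup X] [NormedSpace ℝ X] (d : ℕ)
    (b : Module.Basis (Fin d) ℝ X) (F : Set X) (hF : F.Nonempty) :
    List.TFAE [
      AssouadPatch.AsymptoticallyContainsPatches b F,
      AssouadPatch.AsymptoticSteinhaus F,
      AssouadPatch.assouadDim F = d,
      AssouadPatch.conformalAssouadDim F = d,
      ∃ E : Set X, AssouadPatch.IsWeakTangent E F ∧ (interior E).Nonempty,
      AssouadPatch.IsWeakTangent (Metric.closedBall (0 : X) 1) F] := by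
  have : FiniteDimensional ℝ X := Module.Finite.of_basis b
  have : ProperSpace X := FiniteDimensional.proper_real X
  have hle := AssouadPatch.assouadDim_le_finrank b F
  have hconf := AssouadPatch.conformalAssouadDim_le_assouadDim F
  have hgrid : AssouadPatch.HasLargeGrids d F → AssouadPatch.conformalAssouadDim F = d := fun h =>
    le_antisymm (hconf.trans hle) (AssouadPatch.le_conformalAssouadDim_of_hasLargeGrids h)
  tfae_have 3 → 2 := fun h => AssouadPatch.asymptoticSteinhaus_of_isAlmostDenseInBalls
    (AssouadPatch.isAlmostDenseInBalls_of_assouadDim_eq b hF h)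
  tfae_have 2 → 1 := fun h => h.asymptoticallyContainsPatches b
  tfae_have 1 → 4 := fun h => hgrid (h.hasLargeGrids hF)
  tfae_have 4 → 3 := fun h => le_antisymm hle (h.symm.le.trans hconf)
  tfae_have 3 → 6 := fun h => AssouadPatch.isWeakTangent_closedBall
    (AssouadPatch.isAlmostDenseInBalls_of_assouadDim_eq b hF h)
  tfae_have 6 → 5 := fun h => ⟨_, h, 0, Metric.ball_subset_interior_closedBall
    (Metric.mem_ball_self one_pos)⟩
  tfae_have 5 → 4 := fun ⟨_, hE, hint⟩ =>
    hgrid (AssouadPatch.hasLargeGrids_of_isWeakTangent b hF hE hint)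
  tfae_finish
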